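/- **Theorem 3.1.** Let $\widehat{\mathbb C}=\mathbb C\cup\{\infty\}$, let $J(z)=\overline z$ with $J(\infty)=\infty$, and let $\phi:\widehat{\mathbb C}\to\widehat{\mathbb C}$ be a complex rational map of degree $d$, that is, $\phi=P/Q$ with $P,Q\in\mathbb C[z]$ coprime and $d=\max(\deg P,\deg Q)$. Let $\mathrm{Aut}(\phi)$ be the group of Möbius transformations $T$ with $T\circ\phi\circ T^{-1}=\phi$. An antiholomorphic automorphism of $\phi$ is a map $R=T\circ J$, with $T$ a Möbius transformation, such that $R\circ\phi\circ R^{-1}=\phi$. The map $\phi$ is called real if $T\circ\phi\circ T^{-1}$ is a rational map with real coefficients for some Möbius transformation $T$, and pseudo-real if it admits an antiholomorphic automorphism but is not real. If $\phi$ is pseudo-real, then $\mathrm{Aut}(\phi)$ is either trivial or a finite cyclic group. -/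

import Mathlib

open Polynomial
open scoped OnePoint

noncomputable section

namespace RationalMap

/-- The Riemann sphere. -/
abbrev Sphere : Type := OnePoint ℂ

/-- The self-map `z ↦ P(z) / Q(z)` of the sphere attached to coprime polynomials `P`, `Q`.
At a finite point the value is `∞` exactly when `Q(z) = 0`. The value at `∞` is the ratio of the
coefficients of degree `max (deg P) (deg Q)`, again with the value `∞` when the denominator's
coefficient vanishes. It is used only for coprime `P` and `Q`. -/
def quotientMap (P Q : ℂ[X]) (x : Sphere) : Sphere :=
  x.elim
    (if Q.coeff (max P.natDegree Q.natDegree) = 0 then ∞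
      else ((P.coeff (max P.natDegree Q.natDegree) /
        Q.coeff (max P.natDegree Q.natDegree) : ℂ) : Sphere))
    (fun z => if Q.eval z = 0 then ∞ else ((P.eval z / Q.eval z : ℂ) : Sphere))

/-- The set of complex rational maps of degree `d`, as self-maps of the sphere. -/
def Rat (d : ℕ) : Set (Sphere → Sphere) :=
  {φ | ∃ P Q : ℂ[X], IsCoprime P Q ∧ max P.natDegree Q.natDegree = d ∧ φ = quotientMap P Q}

/-- The set of rational maps of degree `d` with real coefficients. -/
def RealRat (d : ℕ) : Set (Sphere → Sphere) :=
  {φ | ∃ P Q : ℝ[X], IsCoprime P Q ∧ max P.natDegree Q.natDegree = d ∧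
    φ = quotientMap (P.map Complex.ofRealHom) (Q.map Complex.ofRealHom)}

/-- The group of Möbius transformations `z ↦ (a z + b) / (c z + d)`, `a d - b c ≠ 0`, as a group of
permutations of the sphere; it is the faithful image of `PSL₂(ℂ) = PGL₂(ℂ)`. -/
def mobiusGroup : Subgroup (Equiv.Perm Sphere) :=
  (MulAction.toPermHom (GL (Fin 2) ℂ) Sphere).range

/-- Complex conjugation `J(z) = conj z` of the sphere, with `J(∞) = ∞`. -/
def J : Equiv.Perm Sphere :=
  Function.Involutive.toPerm (OnePoint.map (starRingEnd ℂ)) (by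
    intro x
    induction x using OnePoint.rec <;> simp)

/-- The antiholomorphic automorphisms of the sphere: the maps `T ∘ J` with `T` Möbius. -/
def antiMobius : Set (Equiv.Perm Sphere) :=
  {Q | ∃ T ∈ mobiusGroup, Q = T * J}

/-- The conjugate `T ∘ φ ∘ T⁻¹` of a self-map of the sphere. -/
def conj (T : Equiv.Perm Sphere) (φ : Sphere → Sphere) : Sphere → Sphere :=
  T ∘ φ ∘ T.symm

/-- The group of holomorphic automorphisms of `φ`: the Möbius transformations `T` with
`T ∘ φ ∘ T⁻¹ = φ`. -/
def Aut (φ : Sphere → Sphere) : Subgroup (Equiv.Perm Sphere) where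
  carrier := {T | T ∈ mobiusGroup ∧ conj T φ = φ}
  one_mem' := ⟨one_mem _, rfl⟩
  mul_mem' := by
    rintro S T ⟨hS, hS'⟩ ⟨hT, hT'⟩
    refine ⟨mul_mem hS hT, ?_⟩
    have h : conj (S * T) φ = conj S (conj T φ) := rfl
    rw [h, hT', hS']
  inv_mem' := by
    rintro T ⟨hT, hT'⟩
    refine ⟨inv_mem hT, ?_⟩
    have h : conj T⁻¹ (conj T φ) = φ := by
      funext x
      change T.symm (T (φ (T.symm (T x)))) = φ x
      rw [Equiv.symm_apply_apply, Equiv.symm_apply_apply]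
    rw [hT'] at h
    exact h

/-- A rational map `φ` of degree `d` is real if it is Möbius-conjugate to a rational map of degree
`d` with real coefficients. -/
def IsReal (d : ℕ) (φ : Sphere → Sphere) : Prop :=
  ∃ T ∈ mobiusGroup, conj T φ ∈ RealRat d

/-- A rational map `φ` of degree `d` is pseudo-real if it admits an antiholomorphic automorphism
but is not real. -/
def IsPseudoReal (d : ℕ) (φ : Sphere → Sphere) : Prop :=
  (∃ Q ∈ antiMobius, conj Q φ = φ) ∧ ¬ IsReal d φ

end RationalMap

end

/-!
Suppose `φ` has degree at least two and an antiholomorphic automorphism `R`, and that the group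
`G = Aut φ` is not cyclic. It is shown that `φ` is real.

The group `G` is finite (`finite_Aut`): it acts faithfully on the second preimage of the set of
fixed points of `φ`, a finite set with at least three elements. Every nontrivial element of `G` has
exactly two fixed points on the sphere. Burnside's lemma, applied to the points with nontrivial
stabilizer, shows that these form two or three orbits; with two orbits `G` has a global fixed
point, and then it is cyclic (`isCyclic_of_fixed`). So there are exactly three orbits
(`exists_fixed_or_card_orbits_eq_three`). As `R` normalizes `G` and `R ^ 2 ∈ G`, it induces an
involution of this set of three orbits, which fixes one of them. Hence some `g⁻¹ R` with `g ∈ G`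
has a fixed point. Being antiholomorphic with a square of finite order, it is conjugate to complex
conjugation (`exists_conj_J`). The same conjugation turns `φ` into a rational map commuting with
complex conjugation, and such a map has real coefficients (`mem_RealRat_of_commute_J`).

In degree at most one, `Aut φ` is infinite, but every map with an antiholomorphic automorphism is
real (`isReal_of_degree_le_one`): after conjugation it is constant, a translation, or `z ↦ a * z`
with `a` real or of modulus one, and each of these commutes with an explicit reflection.

Rational maps are handled through pairs of binary forms without common zero (`mem_Rat_iff`), for
which stability under Möbius conjugation is a linear substitution.
-/

noncomputable section

namespace RationalMap

/-! ### Homogeneous coordinates on the sphere -/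

/-- The point of the sphere with homogeneous coordinates `[x : y]`. It is meaningful only for
`(x, y) ≠ (0, 0)`. -/
def pt (x y : ℂ) : Sphere := if y = 0 then ∞ else ((x / y : ℂ) : Sphere)

lemma pt_zero (x : ℂ) : pt x 0 = ∞ := by simp [pt]

lemma pt_one (z : ℂ) : pt z 1 = (z : Sphere) := by simp [pt]

lemma pt_of_ne {x y : ℂ} (hy : y ≠ 0) : pt x y = ((x / y : ℂ) : Sphere) := by simp [pt, hy]

lemma pt_eq_infty_iff {x y : ℂ} : pt x y = ∞ ↔ y = 0 := by
  by_cases hy : y = 0 <;> simp [pt, hy]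

lemma pt_smul {c : ℂ} (hc : c ≠ 0) (x y : ℂ) : pt (c * x) (c * y) = pt x y := by
  by_cases hy : y = 0
  · simp [pt, hy]
  · simp [pt, hy, hc, mul_div_mul_left]

/-- To prove a property of all homogeneous coordinates it is enough to prove it for `[z : 1]`
and `[1 : 0]`, and to check that it is invariant under scaling. -/
lemma homogeneous_induction {p : ℂ → ℂ → Prop} (h1 : ∀ z, p z 1) (h0 : p 1 0)
    (hs : ∀ c x y, c ≠ 0 → p x y → p (c * x) (c * y)) {x y : ℂ} (hxy : x ≠ 0 ∨ y ≠ 0) :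
    p x y := by
  by_cases hy : y = 0
  · subst hy
    have := hs x 1 0 (by simpa using hxy) h0
    simpa using this
  · have := hs y (x / y) 1 hy (h1 _)
    rwa [mul_div_cancel₀ _ hy, mul_one] at this

lemma exists_pt (p : Sphere) : ∃ x y : ℂ, (x ≠ 0 ∨ y ≠ 0) ∧ p = pt x y := by
  induction p using OnePoint.rec with
  | infty => exact ⟨1, 0, by simp, (pt_zero 1).symm⟩
  | coe z => exact ⟨z, 1, by simp, (pt_one z).symm⟩

lemma linear_ne_zero {a b c d x y : ℂ} (h : a * d - b * c ≠ 0) (hxy : x ≠ 0 ∨ y ≠ 0) :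
    a * x + b * y ≠ 0 ∨ c * x + d * y ≠ 0 := by
  by_contra! hcon
  obtain ⟨h1, h2⟩ := hcon
  have hx : (a * d - b * c) * x = 0 := by linear_combination d * h1 - b * h2
  have hy : (a * d - b * c) * y = 0 := by linear_combination a * h2 - c * h1
  simp_all

lemma smul_pt (g : GL (Fin 2) ℂ) {x y : ℂ} (hxy : x ≠ 0 ∨ y ≠ 0) :
    g • pt x y = pt (g 0 0 * x + g 0 1 * y) (g 1 0 * x + g 1 1 * y) := by
  refine homogeneous_induction
    (p := fun x y => g • pt x y = pt (g 0 0 * x + g 0 1 * y) (g 1 0 * x + g 1 1 * y))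
    ?_ ?_ ?_ hxy
  · intro z
    rw [pt_one, OnePoint.smul_some_eq_ite]
    simp [pt]
  · rw [pt_zero, OnePoint.smul_infty_eq_ite]
    simp [pt]
  · intro c x y hc h
    have e : ∀ a b : ℂ, a * (c * x) + b * (c * y) = c * (a * x + b * y) := fun a b => by ring
    rw [pt_smul hc, h, e, e, pt_smul hc]

lemma mem_mobiusGroup_iff {T : Equiv.Perm Sphere} :
    T ∈ mobiusGroup ↔ ∃ a b c d : ℂ, a * d - b * c ≠ 0 ∧
      ∀ x y : ℂ, (x ≠ 0 ∨ y ≠ 0) → T (pt x y) = pt (a * x + b * y) (c * x + d * y) := by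
  constructor
  · rintro ⟨g, rfl⟩
    refine ⟨g 0 0, g 0 1, g 1 0, g 1 1, ?_, fun x y hxy => smul_pt g hxy⟩
    have := g.det_ne_zero
    rwa [Matrix.det_fin_two] at this
  · rintro ⟨a, b, c, d, h, hT⟩
    let g : GL (Fin 2) ℂ :=
      Matrix.GeneralLinearGroup.mkOfDetNeZero !![a, b; c, d] (by rwa [Matrix.det_fin_two_of])
    refine ⟨g, Equiv.ext fun p => ?_⟩
    obtain ⟨x, y, hxy, rfl⟩ := exists_pt p
    rw [hT x y hxy]
    exact smul_pt g hxy

/-- The Möbius transformation `z ↦ (a z + b) / (c z + d)`. -/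
lemma exists_mobius {a b c d : ℂ} (h : a * d - b * c ≠ 0) : ∃ T ∈ mobiusGroup,
    ∀ x y : ℂ, (x ≠ 0 ∨ y ≠ 0) → T (pt x y) = pt (a * x + b * y) (c * x + d * y) := by
  let g : GL (Fin 2) ℂ :=
    Matrix.GeneralLinearGroup.mkOfDetNeZero !![a, b; c, d] (by rwa [Matrix.det_fin_two_of])
  exact ⟨MulAction.toPermHom _ _ g, ⟨g, rfl⟩, fun x y hxy => smul_pt g hxy⟩

/-! ### Binary forms and rational maps in homogeneous coordinates -/

/-- The value at `(x, y)` of the binary form `y ^ n * P (x / y)` of degree `n` obtained by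
homogenizing a polynomial `P` of degree at most `n`. -/
def form (P : ℂ[X]) (n : ℕ) (x y : ℂ) : ℂ :=
  ∑ i ∈ Finset.range (n + 1), P.coeff i * x ^ i * y ^ (n - i)

lemma form_of_ne {P : ℂ[X]} {n : ℕ} (hP : P.natDegree ≤ n) (x : ℂ) {y : ℂ} (hy : y ≠ 0) :
    form P n x y = y ^ n * P.eval (x / y) := by
  rw [form, eval_eq_sum_range' (Nat.lt_succ_of_le hP), Finset.mul_sum]
  refine Finset.sum_congr rfl fun i hi => ?_
  have hi' : i ≤ n := by simpa [Nat.lt_succ_iff] using hi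
  have : y ^ n = y ^ (n - i) * y ^ i := by rw [← pow_add, Nat.sub_add_cancel hi']
  rw [this, div_pow]
  field_simp

lemma form_one {P : ℂ[X]} {n : ℕ} (hP : P.natDegree ≤ n) (z : ℂ) :
    form P n z 1 = P.eval z := by
  simp [form_of_ne hP z one_ne_zero]

lemma form_zero (P : ℂ[X]) (n : ℕ) (x : ℂ) : form P n x 0 = P.coeff n * x ^ n := by
  rw [form, Finset.sum_eq_single_of_mem n (by simp)]
  · simp
  · intro i hi hin
    have hi' : i ≤ n := by simpa [Nat.lt_succ_iff] using hi
    rw [zero_pow (by omega), mul_zero]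

lemma form_smul (P : ℂ[X]) (n : ℕ) (c x y : ℂ) :
    form P n (c * x) (c * y) = c ^ n * form P n x y := by
  rw [form, form, Finset.mul_sum]
  refine Finset.sum_congr rfl fun i hi => ?_
  have hi' : i ≤ n := by simpa [Nat.lt_succ_iff] using hi
  have : c ^ n = c ^ (n - i) * c ^ i := by rw [← pow_add, Nat.sub_add_cancel hi']
  rw [this]; ring

lemma form_linear (P Q : ℂ[X]) (n : ℕ) (a b x y : ℂ) :
    form (C a * P + C b * Q) n x y = a * form P n x y + b * form Q n x y := by
  simp only [form, Finset.mul_sum, ← Finset.sum_add_distrib]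
  refine Finset.sum_congr rfl fun i _ => ?_
  simp; ring

lemma form_mul {P Q : ℂ[X]} {m n : ℕ} (hP : P.natDegree ≤ m) (hQ : Q.natDegree ≤ n) (x y : ℂ) :
    form (P * Q) (m + n) x y = form P m x y * form Q n x y := by
  by_cases hy : y = 0
  · subst hy
    rw [form_zero, form_zero, form_zero, coeff_mul_add_eq_of_natDegree_le hP hQ]; ring
  · rw [form_of_ne (natDegree_mul_le.trans (add_le_add hP hQ)) x hy, form_of_ne hP x hy,
      form_of_ne hQ x hy, eval_mul]
    ring

lemma natDegree_linear_pow_le (a b : ℂ) (n : ℕ) : ((C a * X + C b) ^ n).natDegree ≤ n := by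
  have := natDegree_pow_le_of_le n (natDegree_linear_le (a := a) (b := b))
  simpa using this

lemma form_linear_pow (a b : ℂ) (n : ℕ) (x y : ℂ) :
    form ((C a * X + C b) ^ n) n x y = (a * x + b * y) ^ n := by
  induction n with
  | zero => simp [form]
  | succ n ih =>
    rw [pow_succ, form_mul (natDegree_linear_pow_le a b n) natDegree_linear_le, ih, pow_succ]
    congr 1
    simp [form, Finset.sum_range_succ]
    ring

/-- Binary forms of a given degree are stable under linear substitutions. -/
lemma exists_form_comp_linear (P : ℂ[X]) (n : ℕ) (a b c d : ℂ) :
    ∃ P' : ℂ[X], P'.natDegree ≤ n ∧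
      ∀ x y, form P' n x y = form P n (a * x + b * y) (c * x + d * y) := by
  refine ⟨∑ i ∈ Finset.range (n + 1),
    C (P.coeff i) * ((C a * X + C b) ^ i * (C c * X + C d) ^ (n - i)), ?_, fun x y => ?_⟩
  · refine natDegree_sum_le_of_forall_le _ _ fun i hi => ?_
    have hi' : i ≤ n := by simpa [Nat.lt_succ_iff] using hi
    refine (natDegree_C_mul_le _ _).trans (natDegree_mul_le.trans ?_)
    have h1 := natDegree_linear_pow_le a b i
    have h2 := natDegree_linear_pow_le c d (n - i)
    omega
  · have key : ∀ s : Finset ℕ, ∀ F : ℕ → ℂ[X],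
        form (∑ i ∈ s, F i) n x y = ∑ i ∈ s, form (F i) n x y := by
      intro s F
      simp only [form, finsetSum_coeff, Finset.sum_mul]
      rw [Finset.sum_comm]
    rw [key]
    conv_rhs => rw [form]
    refine Finset.sum_congr rfl fun i hi => ?_
    have hi' : i ≤ n := by simpa [Nat.lt_succ_iff] using hi
    have h0 := form_linear ((C a * X + C b) ^ i * (C c * X + C d) ^ (n - i)) 0 n (P.coeff i) 0 x y
    have h1 := form_mul (natDegree_linear_pow_le a b i) (natDegree_linear_pow_le c d (n - i)) x y
    rw [Nat.add_sub_cancel' hi'] at h1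
    rw [mul_zero, add_zero, zero_mul, add_zero, h1, form_linear_pow, form_linear_pow] at h0
    rw [h0]; ring

lemma quotientMap_pt {P Q : ℂ[X]} {d : ℕ} (hd : max P.natDegree Q.natDegree = d) {x y : ℂ}
    (hxy : x ≠ 0 ∨ y ≠ 0) : quotientMap P Q (pt x y) = pt (form P d x y) (form Q d x y) := by
  subst hd
  have hP := le_max_left P.natDegree Q.natDegree
  have hQ := le_max_right P.natDegree Q.natDegree
  refine homogeneous_induction
    (p := fun x y => quotientMap P Q (pt x y) = pt (form P _ x y) (form Q _ x y)) ?_ ?_ ?_ hxy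
  · intro z
    rw [pt_one, form_one hP, form_one hQ]
    rfl
  · rw [pt_zero, form_zero, form_zero, one_pow, mul_one, mul_one]
    rfl
  · intro c x y hc h
    rw [pt_smul hc, h, form_smul, form_smul, pt_smul (pow_ne_zero _ hc)]

/-- A rational map of degree `d` is, in homogeneous coordinates, a pair of binary forms of degree
`d` without common zero. -/
lemma mem_Rat_iff {d : ℕ} {φ : Sphere → Sphere} : φ ∈ Rat d ↔
    ∃ P Q : ℂ[X], P.natDegree ≤ d ∧ Q.natDegree ≤ d ∧
      (∀ x y : ℂ, (x ≠ 0 ∨ y ≠ 0) → form P d x y ≠ 0 ∨ form Q d x y ≠ 0) ∧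
      ∀ x y : ℂ, (x ≠ 0 ∨ y ≠ 0) → φ (pt x y) = pt (form P d x y) (form Q d x y) := by
  constructor
  · rintro ⟨P, Q, hco, hd, rfl⟩
    have hP : P.natDegree ≤ d := hd ▸ le_max_left _ _
    have hQ : Q.natDegree ≤ d := hd ▸ le_max_right _ _
    refine ⟨P, Q, hP, hQ, fun x y hxy => ?_, fun x y hxy => quotientMap_pt hd hxy⟩
    refine homogeneous_induction (p := fun x y => form P d x y ≠ 0 ∨ form Q d x y ≠ 0)
      ?_ ?_ ?_ hxy
    · intro z
      rw [form_one hP, form_one hQ]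
      by_contra! hcon
      obtain ⟨u, v, huv⟩ := hco
      have := congrArg (eval z) huv
      simp [hcon.1, hcon.2] at this
    · rw [form_zero, form_zero, one_pow, mul_one, mul_one]
      by_contra! hcon
      rcases max_choice P.natDegree Q.natDegree with h | h
      · have hPd : P.natDegree = d := h.symm.trans hd
        have hP0 : P = 0 := by
          rw [← leadingCoeff_eq_zero, leadingCoeff, hPd]; exact hcon.1
        have hd0 : d = 0 := by rw [← hPd, hP0, natDegree_zero]
        have hQ0 : Q = 0 := by
          rw [eq_C_of_natDegree_le_zero (p := Q) (hQ.trans hd0.le), ← hd0, hcon.2, C_0]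
        subst hP0 hQ0
        exact not_isCoprime_zero_zero hco
      · have hQd : Q.natDegree = d := h.symm.trans hd
        have hQ0 : Q = 0 := by
          rw [← leadingCoeff_eq_zero, leadingCoeff, hQd]; exact hcon.2
        have hd0 : d = 0 := by rw [← hQd, hQ0, natDegree_zero]
        have hP0 : P = 0 := by
          rw [eq_C_of_natDegree_le_zero (p := P) (hP.trans hd0.le), ← hd0, hcon.1, C_0]
        subst hP0 hQ0
        exact not_isCoprime_zero_zero hco
    · intro c x y hc h
      rw [form_smul, form_smul]
      simpa [hc] using h
  · rintro ⟨P, Q, hP, hQ, h0, hφ⟩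
    have hd : max P.natDegree Q.natDegree = d := by
      refine le_antisymm (max_le hP hQ) ?_
      have := h0 1 0 (by simp)
      rw [form_zero, form_zero, one_pow, mul_one, mul_one] at this
      exact le_max_iff.2 (this.imp le_natDegree_of_ne_zero le_natDegree_of_ne_zero)
    refine ⟨P, Q, ?_, hd, funext fun p => ?_⟩
    · rw [isCoprime_iff_aeval_ne_zero_of_isAlgClosed ℂ ℂ]
      intro z
      have := h0 z 1 (by simp)
      rw [form_one hP, form_one hQ] at this
      simpa using this
    · obtain ⟨x, y, hxy, rfl⟩ := exists_pt p
      rw [hφ x y hxy, quotientMap_pt hd hxy]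

lemma mobius_comp_mem_Rat {d : ℕ} {φ : Sphere → Sphere} (hφ : φ ∈ Rat d)
    {T : Equiv.Perm Sphere} (hT : T ∈ mobiusGroup) : T ∘ φ ∈ Rat d := by
  obtain ⟨P, Q, hP, hQ, h0, hφ⟩ := mem_Rat_iff.1 hφ
  obtain ⟨a, b, c, e, hdet, hT⟩ := mem_mobiusGroup_iff.1 hT
  have deg : ∀ u v : ℂ, (C u * P + C v * Q).natDegree ≤ d := fun u v =>
    natDegree_add_le_of_degree_le ((natDegree_C_mul_le _ _).trans hP)
      ((natDegree_C_mul_le _ _).trans hQ)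
  refine mem_Rat_iff.2 ⟨_, _, deg a b, deg c e, fun x y hxy => ?_, fun x y hxy => ?_⟩
  · rw [form_linear, form_linear]
    exact linear_ne_zero hdet (h0 x y hxy)
  · rw [form_linear, form_linear, Function.comp, hφ x y hxy, hT _ _ (h0 x y hxy)]

lemma comp_mobius_mem_Rat {d : ℕ} {φ : Sphere → Sphere} (hφ : φ ∈ Rat d)
    {T : Equiv.Perm Sphere} (hT : T ∈ mobiusGroup) : φ ∘ T ∈ Rat d := by
  obtain ⟨P, Q, hP, hQ, h0, hφ⟩ := mem_Rat_iff.1 hφ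
  obtain ⟨a, b, c, e, hdet, hT⟩ := mem_mobiusGroup_iff.1 hT
  obtain ⟨P', hP', hPf⟩ := exists_form_comp_linear P d a b c e
  obtain ⟨Q', hQ', hQf⟩ := exists_form_comp_linear Q d a b c e
  refine mem_Rat_iff.2 ⟨P', Q', hP', hQ', fun x y hxy => ?_, fun x y hxy => ?_⟩
  · rw [hPf, hQf]
    exact h0 _ _ (linear_ne_zero hdet hxy)
  · rw [hPf, hQf, Function.comp, hT _ _ hxy, hφ _ _ (linear_ne_zero hdet hxy)]

lemma conj_mem_Rat {d : ℕ} {φ : Sphere → Sphere} (hφ : φ ∈ Rat d)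
    {T : Equiv.Perm Sphere} (hT : T ∈ mobiusGroup) : conj T φ ∈ Rat d :=
  mobius_comp_mem_Rat (comp_mobius_mem_Rat hφ (inv_mem hT)) hT

lemma mobius_mem_Rat_one {T : Equiv.Perm Sphere} (hT : T ∈ mobiusGroup) : ⇑T ∈ Rat 1 := by
  have hid : (id : Sphere → Sphere) ∈ Rat 1 := by
    refine ⟨X, 1, isCoprime_one_right, by simp, funext fun p => ?_⟩
    induction p using OnePoint.rec with
    | infty => simp [quotientMap, coeff_one]
    | coe z => simp [quotientMap]
  exact mobius_comp_mem_Rat hid hT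

/-! ### Möbius and antiholomorphic Möbius transformations -/

lemma J_coe (z : ℂ) : J (z : Sphere) = ((starRingEnd ℂ z : ℂ) : Sphere) := rfl

lemma J_infty : J ∞ = ∞ := rfl

lemma J_pt (x y : ℂ) : J (pt x y) = pt (starRingEnd ℂ x) (starRingEnd ℂ y) := by
  by_cases hy : y = 0
  · simp [pt, hy, J_infty]
  · rw [pt_of_ne hy, pt_of_ne (by simpa using hy), J_coe, map_div₀]

lemma J_mul_J : J * J = 1 := Equiv.ext fun p => by
  induction p using OnePoint.rec with
  | infty => rfl
  | coe z => simp [J_coe]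

lemma J_inv : J⁻¹ = J := inv_eq_of_mul_eq_one_right J_mul_J

lemma J_mul_mobius_mul_J {T : Equiv.Perm Sphere} (hT : T ∈ mobiusGroup) :
    J * T * J ∈ mobiusGroup := by
  obtain ⟨a, b, c, d, h, hT⟩ := mem_mobiusGroup_iff.1 hT
  refine mem_mobiusGroup_iff.2 ⟨starRingEnd ℂ a, starRingEnd ℂ b, starRingEnd ℂ c,
    starRingEnd ℂ d, ?_, fun x y hxy => ?_⟩
  · simpa only [map_sub, map_mul, map_zero] using (map_ne_zero (starRingEnd ℂ)).2 h
  · rw [Equiv.Perm.mul_apply, Equiv.Perm.mul_apply, J_pt, hT _ _ (by simpa using hxy), J_pt]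
    simp

lemma mobius_mul_anti {T R : Equiv.Perm Sphere} (hT : T ∈ mobiusGroup) (hR : R ∈ antiMobius) :
    T * R ∈ antiMobius := by
  obtain ⟨S, hS, rfl⟩ := hR
  exact ⟨T * S, mul_mem hT hS, (mul_assoc _ _ _).symm⟩

lemma anti_mul_anti {R S : Equiv.Perm Sphere} (hR : R ∈ antiMobius) (hS : S ∈ antiMobius) :
    R * S ∈ mobiusGroup := by
  obtain ⟨R, hR, rfl⟩ := hR
  obtain ⟨S, hS, rfl⟩ := hS
  have : R * J * (S * J) = R * (J * S * J) := by group
  rw [this]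
  exact mul_mem hR (J_mul_mobius_mul_J hS)

lemma anti_mul_mobius {T R : Equiv.Perm Sphere} (hR : R ∈ antiMobius) (hT : T ∈ mobiusGroup) :
    R * T ∈ antiMobius := by
  refine ⟨R * T * J, ?_, by rw [mul_assoc, J_mul_J, mul_one]⟩
  rw [mul_assoc]
  exact anti_mul_anti hR ⟨T, hT, rfl⟩

lemma anti_inv {R : Equiv.Perm Sphere} (hR : R ∈ antiMobius) : R⁻¹ ∈ antiMobius := by
  obtain ⟨T, hT, rfl⟩ := hR
  rw [mul_inv_rev, J_inv]
  exact anti_mul_mobius ⟨1, one_mem _, rfl⟩ (inv_mem hT)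

lemma exists_mobius_eq_infty (p : Sphere) : ∃ T ∈ mobiusGroup, T p = ∞ := by
  induction p using OnePoint.rec with
  | infty => exact ⟨1, one_mem _, rfl⟩
  | coe z =>
    obtain ⟨T, hT, h⟩ := exists_mobius (a := 0) (b := 1) (c := 1) (d := -z) (by simp)
    refine ⟨T, hT, ?_⟩
    have := h z 1 (by simp)
    rw [pt_one] at this
    rw [this, pt_eq_infty_iff]
    ring

lemma exists_affine {a : ℂ} (ha : a ≠ 0) (b : ℂ) : ∃ T ∈ mobiusGroup,
    T ∞ = ∞ ∧ ∀ z : ℂ, T z = ((a * z + b : ℂ) : Sphere) := by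
  obtain ⟨T, hT, h⟩ := exists_mobius (a := a) (b := b) (c := 0) (d := 1) (by simpa using ha)
  refine ⟨T, hT, ?_, fun z => ?_⟩
  · have := h 1 0 (by simp)
    rw [pt_zero] at this
    rw [this, pt_eq_infty_iff]
    ring
  · have := h z 1 (by simp)
    rw [pt_one] at this
    rw [this]
    simp [pt]

lemma mobius_affine {T : Equiv.Perm Sphere} (hT : T ∈ mobiusGroup) (h : T ∞ = ∞) :
    ∃ a b : ℂ, a ≠ 0 ∧ ∀ z : ℂ, T z = ((a * z + b : ℂ) : Sphere) := by
  obtain ⟨a, b, c, d, hdet, hT⟩ := mem_mobiusGroup_iff.1 hT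
  have hc : c = 0 := by
    have := hT 1 0 (by simp)
    rw [pt_zero, h, eq_comm, pt_eq_infty_iff] at this
    simpa using this
  subst hc
  have hd : d ≠ 0 := by rintro rfl; simp at hdet
  have ha : a ≠ 0 := by rintro rfl; simp at hdet
  refine ⟨a / d, b / d, div_ne_zero ha hd, fun z => ?_⟩
  have := hT z 1 (by simp)
  rw [pt_one] at this
  rw [this, pt_of_ne (by simpa using hd)]
  rw [OnePoint.coe_eq_coe, zero_mul, zero_add, mul_one, mul_one]
  field_simp

lemma anti_affine {R : Equiv.Perm Sphere} (hR : R ∈ antiMobius) (h : R ∞ = ∞) :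
    ∃ a b : ℂ, a ≠ 0 ∧ ∀ z : ℂ, R z = ((a * starRingEnd ℂ z + b : ℂ) : Sphere) := by
  obtain ⟨T, hT, rfl⟩ := hR
  obtain ⟨a, b, ha, h⟩ := mobius_affine hT h
  exact ⟨a, b, ha, fun z => h _⟩

lemma perm_eq_one_of_coe {T : Equiv.Perm Sphere} (h : T ∞ = ∞)
    (hz : ∀ z : ℂ, T z = (z : Sphere)) : T = 1 := Equiv.ext fun p => by
  induction p using OnePoint.rec with
  | infty => exact h
  | coe z => exact hz z

/-- A Möbius transformation with three distinct fixed points is the identity. -/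
lemma mobius_eq_one_of_fixed {T : Equiv.Perm Sphere} (hT : T ∈ mobiusGroup) {p q r : Sphere}
    (hpq : p ≠ q) (hpr : p ≠ r) (hqr : q ≠ r) (hp : T p = p) (hq : T q = q) (hr : T r = r) :
    T = 1 := by
  obtain ⟨S, hS, hSp⟩ := exists_mobius_eq_infty p
  have fix : ∀ x, T x = x → (S * T * S⁻¹) (S x) = S x := fun x hx => by simp [hx]
  have hU : S * T * S⁻¹ ∈ mobiusGroup := mul_mem (mul_mem hS hT) (inv_mem hS)
  have hUinf : (S * T * S⁻¹) ∞ = ∞ := by have := fix p hp; rwa [hSp] at this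
  obtain ⟨a, b, ha, hab⟩ := mobius_affine hU hUinf
  obtain ⟨u, hu⟩ : ∃ u : ℂ, (u : Sphere) = S q := OnePoint.ne_infty_iff_exists.1 fun h =>
    hpq (S.injective (hSp.trans h.symm))
  obtain ⟨v, hv⟩ : ∃ v : ℂ, (v : Sphere) = S r := OnePoint.ne_infty_iff_exists.1 fun h =>
    hpr (S.injective (hSp.trans h.symm))
  have huv : u - v ≠ 0 := sub_ne_zero.2 fun h => hqr (S.injective (by rw [← hu, ← hv, h]))
  have h1 := fix q hq
  have h2 := fix r hr
  rw [← hu, hab, OnePoint.coe_eq_coe] at h1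
  rw [← hv, hab, OnePoint.coe_eq_coe] at h2
  have ha1 : a = 1 := by
    have : (a - 1) * (u - v) = 0 := by linear_combination h1 - h2
    exact sub_eq_zero.1 ((mul_eq_zero.1 this).resolve_right huv)
  have hb : b = 0 := by rw [ha1] at h1; linear_combination h1
  have h1 : S * T * S⁻¹ = 1 := perm_eq_one_of_coe hUinf fun z => by rw [hab, ha1, hb]; simp
  simpa [mul_assoc] using congrArg (fun U => S⁻¹ * U * S) h1

lemma translation_pow {T : Equiv.Perm Sphere} {b : ℂ}
    (hz : ∀ z : ℂ, T z = ((z + b : ℂ) : Sphere)) (n : ℕ) (z : ℂ) :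
    (T ^ n) z = ((z + n * b : ℂ) : Sphere) := by
  induction n generalizing z with
  | zero => simp
  | succ n ih =>
    rw [pow_succ, Equiv.Perm.mul_apply, hz, ih, OnePoint.coe_eq_coe]
    push_cast
    ring

/-- A translation of finite order is trivial. -/
lemma translation_eq_one {T : Equiv.Perm Sphere} (hT : IsOfFinOrder T) {b : ℂ}
    (h : T ∞ = ∞) (hz : ∀ z : ℂ, T z = ((z + b : ℂ) : Sphere)) : T = 1 := by
  obtain ⟨n, hn, hpow⟩ := isOfFinOrder_iff_pow_eq_one.1 hT
  have h0 := translation_pow hz n 0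
  rw [hpow, Equiv.Perm.one_apply, OnePoint.coe_eq_coe, zero_add, eq_comm, mul_eq_zero] at h0
  have hb : b = 0 := h0.resolve_left (by exact_mod_cast hn.ne')
  exact perm_eq_one_of_coe h fun z => by rw [hz, hb, add_zero]

/-- Every rational map has a fixed point: either `∞` or a root of `P - X * Q`. -/
lemma exists_fixedPoint {d : ℕ} {φ : Sphere → Sphere} (hφ : φ ∈ Rat d) : ∃ p, φ p = p := by
  obtain ⟨P, Q, hP, hQ, h0, hφ⟩ := mem_Rat_iff.1 hφ
  by_cases hq : Q.coeff d = 0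
  · refine ⟨∞, ?_⟩
    have := hφ 1 0 (by simp)
    rwa [form_zero Q, hq, zero_mul, pt_zero, pt_zero] at this
  · have hdeg : (P - X * Q).natDegree = d + 1 := by
      have hco : (P - X * Q).coeff (d + 1) ≠ 0 := by
        rw [coeff_sub, coeff_X_mul, coeff_eq_zero_of_natDegree_lt (Nat.lt_succ_of_le hP)]
        simpa using hq
      refine le_antisymm ?_ (le_natDegree_of_ne_zero hco)
      refine natDegree_sub_le_of_le (hP.trans d.le_succ) (natDegree_mul_le.trans ?_) |>.trans
        (max_self _).le
      rw [natDegree_X]; omega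
    obtain ⟨z, hz⟩ := IsAlgClosed.exists_root (P - X * Q) (by
      intro h
      rw [degree_eq_natDegree (by rintro h'; simp [h'] at hdeg), hdeg] at h
      exact absurd h (by exact_mod_cast d.succ_ne_zero))
    refine ⟨z, ?_⟩
    have h1 := hφ z 1 (by simp)
    have h2 := h0 z 1 (by simp)
    rw [form_one hP, form_one hQ] at h1 h2
    have hz' : P.eval z = z * Q.eval z := by simpa [sub_eq_zero] using hz
    have hQz : Q.eval z ≠ 0 := by
      intro h; rw [hz', h, mul_zero] at h2; simp at h2
    rw [pt_one] at h1
    rw [h1, pt_of_ne hQz, hz', mul_div_cancel_right₀ _ hQz]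

/-- A nontrivial Möbius transformation of finite order has exactly two fixed points. -/
lemma mobius_fixed_pair {T : Equiv.Perm Sphere} (hT : T ∈ mobiusGroup) (hfin : IsOfFinOrder T)
    (h1 : T ≠ 1) : ∃ p q, p ≠ q ∧ ∀ x, T x = x ↔ x = p ∨ x = q := by
  obtain ⟨p, hp⟩ := exists_fixedPoint (mobius_mem_Rat_one hT)
  suffices ∃ q, p ≠ q ∧ T q = q by
    obtain ⟨q, hpq, hq⟩ := this
    refine ⟨p, q, hpq, fun x => ⟨fun hx => ?_, by rintro (rfl | rfl) <;> assumption⟩⟩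
    by_contra! hcon
    exact h1 (mobius_eq_one_of_fixed hT hpq hcon.1.symm hcon.2.symm hp hq hx)
  obtain ⟨S, hS, hSp⟩ := exists_mobius_eq_infty p
  have hSinv : S.symm ∞ = p := by rw [← hSp]; simp
  have hU : S * T * S⁻¹ ∈ mobiusGroup := mul_mem (mul_mem hS hT) (inv_mem hS)
  have hUinf : (S * T * S⁻¹) ∞ = ∞ := by simp [hSinv, hp, hSp]
  have hUfin : IsOfFinOrder (S * T * S⁻¹) := by
    simpa using (MulAut.conj S).toMonoidHom.isOfFinOrder hfin
  obtain ⟨a, b, ha, hab⟩ := mobius_affine hU hUinf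
  by_cases ha1 : a = 1
  · subst ha1
    have := translation_eq_one hUfin hUinf (b := b) fun z => by rw [hab, one_mul]
    exact absurd (by simpa [mul_assoc] using congrArg (fun U => S⁻¹ * U * S) this) h1
  · have ha1' : 1 - a ≠ 0 := sub_ne_zero.2 (Ne.symm ha1)
    refine ⟨S.symm ((b / (1 - a) : ℂ) : Sphere), ?_, ?_⟩
    · rw [← hSinv]
      exact fun h => OnePoint.infty_ne_coe _ (S.symm.injective h)
    · apply S.injective
      have := hab (b / (1 - a))
      rw [Equiv.Perm.mul_apply, Equiv.Perm.mul_apply] at this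
      rw [Equiv.apply_symm_apply]
      refine this.trans ?_
      rw [OnePoint.coe_eq_coe]
      field_simp
      ring

/-- A finite group of Möbius transformations with a common fixed point is cyclic: after moving
the fixed point to `∞` the elements are affine, and an affine map of finite order is determined
within the group by its linear coefficient. -/
lemma isCyclic_of_fixed {G : Subgroup (Equiv.Perm Sphere)} [Finite G] (hG : G ≤ mobiusGroup)
    {p : Sphere} (hp : ∀ g ∈ G, g p = p) : IsCyclic G := by
  obtain ⟨S, hS, hSp⟩ := exists_mobius_eq_infty p
  have hSinv : S.symm ∞ = p := by rw [← hSp]; simp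
  have hinf : ∀ g : G, (S * g * S⁻¹) ∞ = ∞ := fun g => by simp [hSinv, hp g g.2, hSp]
  have key : ∀ g : G, ∃ a b : ℂ, ∀ z : ℂ, (S * g * S⁻¹) z = ((a * z + b : ℂ) : Sphere) :=
    fun g => by
      obtain ⟨a, b, -, h⟩ :=
        mobius_affine (mul_mem (mul_mem hS (hG g.2)) (inv_mem hS)) (hinf g)
      exact ⟨a, b, h⟩
  choose a b hab using key
  have hconj : ∀ g h : G, S * ↑(g * h) * S⁻¹ = (S * g * S⁻¹) * (S * h * S⁻¹) := fun g h => by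
    rw [Subgroup.coe_mul]; group
  have uniq : ∀ (g : G) (a' b' : ℂ),
      (∀ z : ℂ, (S * g * S⁻¹) z = ((a' * z + b' : ℂ) : Sphere)) → a g = a' := by
    intro g a' b' h
    have h0 := (hab g 0).symm.trans (h 0)
    have h1 := (hab g 1).symm.trans (h 1)
    rw [OnePoint.coe_eq_coe] at h0 h1
    linear_combination h1 - h0
  let f : G →* ℂ :=
    { toFun := a
      map_one' := uniq 1 1 0 fun z => by simp
      map_mul' := fun g h => uniq _ _ (a g * b h + b g) fun z => by
        rw [hconj, Equiv.Perm.mul_apply, hab, hab, OnePoint.coe_eq_coe]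
        ring }
  refine isCyclic_of_injective_ringHom f ((injective_iff_map_eq_one f).2 fun g hg => ?_)
  have hg : a g = 1 := hg
  have hfin : IsOfFinOrder (S * g * S⁻¹) := by
    simpa using (MulAut.conj S).toMonoidHom.isOfFinOrder
      (G.subtype.isOfFinOrder (isOfFinOrder_of_finite g))
  have := translation_eq_one hfin (hinf g) (b := b g) fun z => by rw [hab, hg, one_mul]
  exact Subtype.ext (by simpa [mul_assoc] using congrArg (fun U => S⁻¹ * U * S) this)

/-! ### Finiteness of the automorphism group -/

lemma conj_eq_iff {φ : Sphere → Sphere} {T : Equiv.Perm Sphere} :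
    conj T φ = φ ↔ ∀ x, T (φ x) = φ (T x) := by
  constructor
  · intro h x
    have := congrFun h (T x)
    simpa [conj] using this
  · intro h
    funext x
    simp [conj, h]

lemma fiber_infty_finite {d : ℕ} (hd : 1 ≤ d) {φ : Sphere → Sphere} (hφ : φ ∈ Rat d) :
    {x | φ x = ∞}.Finite := by
  obtain ⟨P, Q, hco, hdeg, rfl⟩ := hφ
  have hQ : Q ≠ 0 := by
    rintro rfl
    have := natDegree_eq_zero_of_isUnit (isCoprime_zero_right.1 hco)
    simp [this] at hdeg
    omega
  refine (((Q.rootSet_finite ℂ).image ((↑) : ℂ → Sphere)).insert ∞).subset fun x hx => ?_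
  induction x using OnePoint.rec with
  | infty => exact Set.mem_insert _ _
  | coe z =>
    refine Set.mem_insert_of_mem _ ⟨z, ?_, rfl⟩
    rw [mem_rootSet_of_ne hQ]
    by_contra h
    have h' : Q.eval z ≠ 0 := by simpa using h
    simp [quotientMap, h'] at hx

lemma fiber_finite {d : ℕ} (hd : 1 ≤ d) {φ : Sphere → Sphere} (hφ : φ ∈ Rat d) (y : Sphere) :
    {x | φ x = y}.Finite := by
  obtain ⟨T, hT, hy⟩ := exists_mobius_eq_infty y
  refine (fiber_infty_finite hd (mobius_comp_mem_Rat hφ hT)).subset fun x hx => ?_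
  have hx : φ x = y := hx
  simp [hx, hy]

lemma exists_eq_infty {d : ℕ} (hd : 1 ≤ d) {φ : Sphere → Sphere} (hφ : φ ∈ Rat d) :
    ∃ x, φ x = ∞ := by
  obtain ⟨P, Q, hP, hQ, h0, hφ⟩ := mem_Rat_iff.1 hφ
  by_cases hq : Q.coeff d = 0
  · refine ⟨pt 1 0, ?_⟩
    rw [hφ 1 0 (by simp), pt_eq_infty_iff, form_zero, hq, zero_mul]
  · have hQd : d ≤ Q.natDegree := le_natDegree_of_ne_zero hq
    obtain ⟨z, hz⟩ := IsAlgClosed.exists_root Q fun h => by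
      have : Q.natDegree = 0 := natDegree_eq_of_degree_eq_some h
      omega
    exact ⟨pt z 1, by rw [hφ z 1 (by simp), pt_eq_infty_iff, form_one hQ]; exact hz⟩

lemma Rat_surjective {d : ℕ} (hd : 1 ≤ d) {φ : Sphere → Sphere} (hφ : φ ∈ Rat d) :
    Function.Surjective φ := by
  intro y
  obtain ⟨T, hT, hy⟩ := exists_mobius_eq_infty y
  obtain ⟨x, hx⟩ := exists_eq_infty hd (mobius_comp_mem_Rat hφ hT)
  exact ⟨x, T.injective (hx.trans hy.symm)⟩

lemma fixed_finite {d : ℕ} (hd : 2 ≤ d) {φ : Sphere → Sphere} (hφ : φ ∈ Rat d) :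
    {x | φ x = x}.Finite := by
  obtain ⟨P, Q, hco, hdeg, rfl⟩ := hφ
  have hne : P - X * Q ≠ 0 := by
    intro h
    have hP : P = X * Q := sub_eq_zero.1 h
    have hQ : IsUnit Q := by
      rw [hP] at hco
      exact isCoprime_self.1 hco.of_mul_left_right
    obtain ⟨c, hc, rfl⟩ := isUnit_iff.1 hQ
    have h1 : P.natDegree ≤ 1 := hP ▸ natDegree_mul_le.trans (by simp)
    have h2 : (C c : ℂ[X]).natDegree = 0 := natDegree_C c
    omega
  refine ((((P - X * Q).rootSet_finite ℂ).image ((↑) : ℂ → Sphere)).insert ∞).subset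
    fun x hx => ?_
  induction x using OnePoint.rec with
  | infty => exact Set.mem_insert _ _
  | coe z =>
    refine Set.mem_insert_of_mem _ ⟨z, ?_, rfl⟩
    rw [mem_rootSet_of_ne hne]
    by_cases h : Q.eval z = 0
    · simp [quotientMap, h] at hx
    · have hx : P.eval z / Q.eval z = z := by simpa [quotientMap, h] using hx
      rw [div_eq_iff h] at hx
      simp [hx]

/-- A rational map without finite poles is a polynomial. -/
lemma exists_polynomial {d : ℕ} {φ : Sphere → Sphere} (hφ : φ ∈ Rat d)
    (h : ∀ z : ℂ, φ z ≠ ∞) :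
    ∃ P : ℂ[X], P.natDegree = d ∧ ∀ z : ℂ, φ z = ((P.eval z : ℂ) : Sphere) := by
  obtain ⟨P, Q, hco, hdeg, rfl⟩ := hφ
  have hQ : ∀ z, Q.eval z ≠ 0 := fun z hz => h z (by simp [quotientMap, hz])
  have hQ0 : Q.natDegree = 0 := by
    by_contra hcon
    obtain ⟨z, hz⟩ := IsAlgClosed.exists_root Q fun h => hcon (natDegree_eq_of_degree_eq_some h)
    exact hQ z hz
  obtain ⟨c, rfl⟩ := natDegree_eq_zero.1 hQ0
  have hc : c ≠ 0 := by simpa using hQ 0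
  refine ⟨C c⁻¹ * P, ?_, fun z => ?_⟩
  · rw [natDegree_C_mul (inv_ne_zero hc)]
    simpa using hdeg
  · simp [quotientMap, hc, div_eq_inv_mul]

/-- If all roots of a polynomial of degree at least two are equal to `q`, it is divisible by
`(X - q) ^ 2`. -/
lemma sq_dvd_of_roots {P : ℂ[X]} (hP : 2 ≤ P.natDegree) {q : ℂ}
    (h : ∀ z, P.eval z = 0 → z = q) : (X - C q) ^ 2 ∣ P := by
  have hP0 : P ≠ 0 := by rintro rfl; simp at hP
  rw [← le_rootMultiplicity_iff hP0, ← count_roots,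
    Multiset.eq_replicate_card.2 fun z hz => h z (isRoot_of_mem_roots hz),
    Multiset.count_replicate_self, ← (IsAlgClosed.splits P).natDegree_eq_card_roots]
  exact hP

/-- A polynomial of degree at least two which is injective over its fixed points has two distinct
finite fixed points: if `q` were the only one, `P - X` and `P - q` would both be divisible by
`(X - q) ^ 2`, hence so would their difference `X - q`. -/
lemma exists_two_fixed {d : ℕ} (hd : 2 ≤ d) {φ : Sphere → Sphere} (hφ : φ ∈ Rat d)
    (hinf : φ ∞ = ∞) (h : ∀ x, φ (φ x) = φ x → φ x = x) :
    ∃ q r : ℂ, q ≠ r ∧ φ q = q ∧ φ r = r := by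
  have hpole : ∀ z : ℂ, φ z ≠ ∞ := fun z hz => by
    have := h z (by rw [hz, hinf])
    rw [hz] at this
    exact OnePoint.infty_ne_coe _ this
  obtain ⟨P, hP, hφP⟩ := exists_polynomial hφ hpole
  have hdegX : (P - X).natDegree = d := by
    rw [natDegree_sub_eq_left_of_natDegree_lt (by rw [natDegree_X]; omega), hP]
  obtain ⟨q, hq⟩ := IsAlgClosed.exists_root (P - X) fun h => by
    have : (P - X).natDegree = 0 := natDegree_eq_of_degree_eq_some h
    omega
  have hq : P.eval q = q := by simpa [sub_eq_zero] using hq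
  by_contra! hcon
  have h1 : (X - C q) ^ 2 ∣ P - X := sq_dvd_of_roots (hdegX ▸ hd) fun z hz => by
    by_contra hzq
    have hz : P.eval z = z := by simpa [sub_eq_zero] using hz
    exact hcon q z (Ne.symm hzq) (by rw [hφP, hq]) (by rw [hφP, hz])
  have h2 : (X - C q) ^ 2 ∣ P - C q :=
    sq_dvd_of_roots (by rw [natDegree_sub_C, hP]; exact hd) fun z hz => by
      have hz : P.eval z = q := by simpa [sub_eq_zero] using hz
      have := h z (by rw [hφP z, hz, hφP, hq])
      rw [hφP, hz, OnePoint.coe_eq_coe] at this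
      exact this.symm
  have h3 : (X - C q) ^ 2 ∣ X - C q := by
    have := dvd_sub h2 h1
    rwa [sub_sub_sub_cancel_left] at this
  have := natDegree_le_of_dvd h3 (X_sub_C_ne_zero q)
  rw [natDegree_pow, natDegree_X_sub_C] at this
  omega

/-- The second preimage of the fixed point set of a rational map of degree at least two has at
least three elements. -/
lemma exists_three_points {d : ℕ} (hd : 2 ≤ d) {φ : Sphere → Sphere} (hφ : φ ∈ Rat d) :
    ∃ p q r : Sphere, p ≠ q ∧ p ≠ r ∧ q ≠ r ∧ φ (φ (φ p)) = φ (φ p) ∧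
      φ (φ (φ q)) = φ (φ q) ∧ φ (φ (φ r)) = φ (φ r) := by
  obtain ⟨p, hp⟩ := exists_fixedPoint hφ
  by_cases h : ∀ x, φ (φ x) = φ x → φ x = x
  · obtain ⟨T, hT, hTp⟩ := exists_mobius_eq_infty p
    have hTinv : T.symm ∞ = p := by rw [← hTp]; simp
    obtain ⟨q, r, hqr, hq, hr⟩ := exists_two_fixed hd (conj_mem_Rat hφ hT)
      (by simp [conj, hTinv, hp, hTp]) (fun x hx => by
        have := h (T.symm x) (by simpa [conj] using hx)
        simp [conj, this])
    have fix : ∀ z : Sphere, conj T φ z = z → φ (T.symm z) = T.symm z := fun z hz => by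
      have := congrArg T.symm hz
      simpa [conj] using this
    have hq := fix _ hq
    have hr := fix _ hr
    refine ⟨p, T.symm q, T.symm r, ?_, ?_, ?_, ?_, ?_, ?_⟩
    · rw [← hTinv]
      exact fun h => OnePoint.infty_ne_coe _ (T.symm.injective h)
    · rw [← hTinv]
      exact fun h => OnePoint.infty_ne_coe _ (T.symm.injective h)
    · exact fun h => hqr (OnePoint.coe_injective (T.symm.injective h))
    · simp [hp]
    · simp [hq]
    · simp [hr]
  · push Not at h
    obtain ⟨b, hb, hb'⟩ := h
    obtain ⟨c, hc⟩ := Rat_surjective (by omega) hφ b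
    refine ⟨p, b, c, ?_, ?_, ?_, ?_, ?_, ?_⟩
    · rintro rfl; exact hb' hp
    · rintro rfl
      rw [hp] at hc
      subst hc
      exact hb' hp
    · rintro rfl; exact hb' hc
    · simp [hp]
    · simp [hb]
    · rw [hc, hb]

/-- The automorphism group of a rational map of degree at least two is finite: it acts on the
second preimage of the fixed point set, a finite set with at least three elements. -/
lemma finite_Aut {d : ℕ} (hd : 2 ≤ d) {φ : Sphere → Sphere} (hφ : φ ∈ Rat d) :
    Finite (Aut φ) := by
  have hpre : ∀ s : Set Sphere, s.Finite → (φ ⁻¹' s).Finite := fun s hs =>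
    hs.preimage' fun y _ => fiber_finite (by omega) hφ y
  have hC := hpre _ (hpre _ (fixed_finite hd hφ))
  obtain ⟨p, q, r, hpq, hpr, hqr, hp, hq, hr⟩ := exists_three_points hd hφ
  have := hC.to_subtype
  have hcomm : ∀ g : Aut φ, ∀ x, g.1 (φ x) = φ (g.1 x) := fun g => conj_eq_iff.1 g.2.2
  have hinv : ∀ g : Aut φ, ∀ x ∈ φ ⁻¹' (φ ⁻¹' {x | φ x = x}),
      g.1 x ∈ φ ⁻¹' (φ ⁻¹' {x | φ x = x}) := fun g x hx => by
    have hx : φ (φ (φ x)) = φ (φ x) := hx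
    change φ (φ (φ (g.1 x))) = φ (φ (g.1 x))
    rw [← hcomm, ← hcomm, ← hcomm, hx]
  refine Finite.of_injective (fun g : Aut φ =>
    ((⟨g.1 p, hinv g p hp⟩, ⟨g.1 q, hinv g q hq⟩, ⟨g.1 r, hinv g r hr⟩) :
      (φ ⁻¹' (φ ⁻¹' {x | φ x = x})) × (φ ⁻¹' (φ ⁻¹' {x | φ x = x})) ×
        (φ ⁻¹' (φ ⁻¹' {x | φ x = x})))) fun g h hgh => ?_
  simp only [Prod.mk.injEq, Subtype.mk.injEq] at hgh
  have key : ∀ x, g.1 x = h.1 x → (h.1⁻¹ * g.1) x = x := fun x hx => by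
    rw [Equiv.Perm.mul_apply, hx]; simp
  have := mobius_eq_one_of_fixed (mul_mem (inv_mem h.2.1) g.2.1) hpq hpr hqr
    (key p hgh.1) (key q hgh.2.1) (key r hgh.2.2)
  exact Subtype.ext (inv_mul_eq_one.1 this).symm

/-! ### Counting orbits of poles -/

/-- An involution of a set with exactly three elements has a fixed point. -/
lemma exists_fixed_of_card_three {X : Type*} [Finite X] (hX : Nat.card X = 3) {f : X → X}
    (hf : Function.Involutive f) : ∃ x, f x = x := by
  have := Fintype.ofFinite X
  rw [Nat.card_eq_fintype_card] at hX
  refine Equiv.Perm.exists_fixed_point_of_prime (p := 2) (n := 1) (σ := hf.toPerm) ?_ ?_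
  · rw [hX]; decide
  · rw [pow_one, pow_two]
    exact Equiv.ext hf

/-- The points with nontrivial stabilizer under a group action. -/
def poles (G : Type*) [Group G] (α : Type*) [MulAction G α] : SubMulAction G α where
  carrier := {x | ∃ g : G, g ≠ 1 ∧ g • x = x}
  smul_mem' h x := by
    rintro ⟨g, hg, hx⟩
    refine ⟨h * g * h⁻¹, fun e => hg (by simpa using e), ?_⟩
    rw [mul_smul, inv_smul_smul, mul_smul, hx]

open scoped Classical in
/-- If every nontrivial element of a nontrivial finite group has exactly two fixed points, then
either the group has a global fixed point or its poles form exactly three orbits. -/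
lemma exists_fixed_or_card_orbits_eq_three {G α : Type*} [Group G] [Finite G] [Nontrivial G]
    [MulAction G α]
    (hfix : ∀ g : G, g ≠ 1 → ∃ p q : α, p ≠ q ∧ ∀ x, g • x = x ↔ x = p ∨ x = q) :
    (∃ x : α, ∀ g : G, g • x = x) ∨
      Finite (MulAction.orbitRel.Quotient G (poles G α)) ∧
        Nat.card (MulAction.orbitRel.Quotient G (poles G α)) = 3 := by
  have := Fintype.ofFinite G
  obtain ⟨g₀, hg₀⟩ := exists_ne (1 : G)
  have : Nonempty α := (hfix g₀ hg₀).nonempty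
  choose! p q hpq hx using hfix
  let F : Finset α := (Finset.univ.erase (1 : G)).biUnion fun g => {p g, q g}
  have hF : ∀ x, x ∈ poles G α ↔ x ∈ F := by
    intro x
    simp only [F, Finset.mem_biUnion, Finset.mem_erase, Finset.mem_univ, and_true,
      Finset.mem_insert, Finset.mem_singleton]
    exact exists_congr fun g => and_congr_right fun hg => hx g hg x
  let _ : Fintype (poles G α) := Fintype.ofFinset F fun x => (hF x).symm
  have hcard : Fintype.card (poles G α) ≤ 2 * (Fintype.card G - 1) := by
    have h1 : Fintype.card (poles G α) = F.card := Fintype.card_ofFinset F _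
    rw [h1, mul_comm]
    refine (Finset.card_biUnion_le_card_mul _ _ 2 fun g _ => Finset.card_le_two).trans ?_
    rw [Finset.card_erase_of_mem (Finset.mem_univ _), Finset.card_univ]
  have hfixcard : ∀ g : G, g ≠ 1 →
      Fintype.card (MulAction.fixedBy (poles G α) g) = 2 := by
    intro g hg
    have hp : p g ∈ poles G α := ⟨g, hg, (hx g hg _).2 (Or.inl rfl)⟩
    have hq : q g ∈ poles G α := ⟨g, hg, (hx g hg _).2 (Or.inr rfl)⟩
    have hset : MulAction.fixedBy (poles G α) g = {⟨p g, hp⟩, ⟨q g, hq⟩} := by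
      ext x
      simp only [MulAction.mem_fixedBy, Set.mem_insert_iff, Set.mem_singleton_iff, Subtype.ext_iff]
      exact hx g hg x
    rw [← Nat.card_eq_fintype_card, Nat.card_congr (Equiv.setCongr hset), Nat.card_coe_set_eq,
      Set.ncard_pair fun h => hpq g hg (congrArg Subtype.val h)]
  have hburn := MulAction.sum_card_fixedBy_eq_card_orbits_mul_card_group G (poles G α)
  rw [← Finset.add_sum_erase _ _ (Finset.mem_univ (1 : G)),
    Finset.sum_congr rfl fun g hg => hfixcard g (Finset.ne_of_mem_erase hg), Finset.sum_const,
    Finset.card_erase_of_mem (Finset.mem_univ _), Finset.card_univ, smul_eq_mul,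
    show Fintype.card (MulAction.fixedBy (poles G α) (1 : G)) = Fintype.card (poles G α) from
      Fintype.card_congr (Equiv.subtypeUnivEquiv fun x => one_smul G x)] at hburn
  have hG : 1 < Fintype.card G := Fintype.one_lt_card
  have hX : 2 ≤ Fintype.card (poles G α) := by
    rw [← hfixcard g₀ hg₀]
    exact Fintype.card_subtype_le _
  generalize hk : Fintype.card (MulAction.orbitRel.Quotient G (poles G α)) = k at hburn
  generalize hN : Fintype.card G = N at *
  obtain ⟨M, rfl⟩ : ∃ M, N = M + 1 := ⟨N - 1, by omega⟩
  rw [Nat.add_sub_cancel] at hburn hcard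
  have hk4 : k < 4 := by nlinarith
  have hk2 : 2 ≤ k := by nlinarith
  obtain rfl | rfl : k = 2 ∨ k = 3 := by omega
  · -- As many orbits as poles, so every pole is fixed by the group.
    left
    have hc : Fintype.card (poles G α) =
        Fintype.card (MulAction.orbitRel.Quotient G (poles G α)) := by omega
    have hinj := ((Fintype.bijective_iff_surjective_and_card
      (Quotient.mk'' : poles G α → MulAction.orbitRel.Quotient G (poles G α))).2
        ⟨Quotient.mk''_surjective, hc⟩).1
    obtain ⟨x⟩ : Nonempty (poles G α) := Fintype.card_pos_iff.1 (by omega)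
    refine ⟨x, fun g => ?_⟩
    have : g • x = x := hinj (Quotient.sound' (MulAction.orbitRel_apply.2 ⟨g, rfl⟩))
    exact congrArg Subtype.val this
  · right
    exact ⟨inferInstance, by rw [Nat.card_eq_fintype_card, hk]⟩

/-- Let every nontrivial element of a nontrivial finite group `G` have exactly two fixed points,
and let `σ` normalize the action, with square acting as an element of `G`. Without a global fixed
point there are three orbits of poles, so the involution induced by `σ` fixes an orbit. -/
lemma exists_fixed_or_normalizer_fixed {G α : Type*} [Group G] [Finite G] [Nontrivial G]
    [MulAction G α] [FaithfulSMul G α]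
    (hfix : ∀ g : G, g ≠ 1 → ∃ p q : α, p ≠ q ∧ ∀ x, g • x = x ↔ x = p ∨ x = q)
    (σ : Equiv.Perm α) (hσ : ∀ g : G, ∃ g' : G, ∀ x, σ (g • x) = g' • σ x)
    (hσ2 : ∃ g : G, ∀ x, σ (σ x) = g • x) :
    (∃ x : α, ∀ g : G, g • x = x) ∨ ∃ (x : α) (g : G), σ x = g • x := by
  refine (exists_fixed_or_card_orbits_eq_three hfix).imp_right ?_
  rintro ⟨hfin, hcard⟩
  have hpole : ∀ x ∈ poles G α, σ x ∈ poles G α := by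
    rintro x ⟨g, hg, hx⟩
    obtain ⟨g', hg'⟩ := hσ g
    refine ⟨g', fun h => hg (eq_of_smul_eq_smul (α := α) fun y => ?_), by rw [← hg', hx]⟩
    rw [one_smul]
    exact σ.injective (by rw [hg', h, one_smul])
  let τ : poles G α → poles G α := fun x => ⟨σ x, hpole x x.2⟩
  let f : MulAction.orbitRel.Quotient G (poles G α) → MulAction.orbitRel.Quotient G (poles G α) :=
    Quotient.map' τ (by
      rintro x y hxy
      obtain ⟨g, rfl⟩ := MulAction.orbitRel_apply.1 hxy
      obtain ⟨g', hg'⟩ := hσ g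
      exact MulAction.orbitRel_apply.2 ⟨g', Subtype.ext (hg' y).symm⟩)
  obtain ⟨x, hx⟩ := exists_fixed_of_card_three hcard (f := f) (by
    intro x
    induction x using Quotient.inductionOn' with | h x => ?_
    obtain ⟨g, hg⟩ := hσ2
    exact Quotient.sound' (MulAction.orbitRel_apply.2 ⟨g, Subtype.ext (hg x).symm⟩))
  induction x using Quotient.inductionOn' with | h x => ?_
  obtain ⟨g, hg⟩ := MulAction.orbitRel_apply.1 (Quotient.eq''.1 hx)
  exact ⟨x, g, (congrArg Subtype.val hg).symm⟩

/-! ### Rational maps commuting with a reflection are real -/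

lemma eval_map_conj (P : ℂ[X]) (z : ℂ) :
    (P.map (starRingEnd ℂ)).eval z = starRingEnd ℂ (P.eval (starRingEnd ℂ z)) := by
  have := eval_map_apply (p := P) (starRingEnd ℂ) (starRingEnd ℂ z)
  rwa [Complex.conj_conj] at this

lemma exists_real_polynomial {P : ℂ[X]} (h : ∀ i, starRingEnd ℂ (P.coeff i) = P.coeff i) :
    ∃ P' : ℝ[X], P'.map Complex.ofRealHom = P := by
  rw [← mem_lifts, lifts_iff_coeff_lifts]
  intro i
  obtain ⟨r, hr⟩ := Complex.conj_eq_iff_real.1 (h i)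
  exact ⟨r, hr.symm⟩

lemma quotientMap_C_mul {c : ℂ} (hc : c ≠ 0) (P Q : ℂ[X]) :
    quotientMap (C c * P) (C c * Q) = quotientMap P Q := by
  funext x
  induction x using OnePoint.rec with
  | infty =>
    simp [quotientMap, natDegree_C_mul hc, hc, mul_div_mul_left]
  | coe z => simp [quotientMap, hc, mul_div_mul_left]

/-- A rational map commuting with complex conjugation has real coefficients. If `P / Q` is
invariant under conjugation of the coefficients, then so is the pair `(P, Q)` up to a constant,
and dividing by any nonzero coefficient makes all coefficients real. -/
lemma mem_RealRat_of_commute_J {d : ℕ} {φ : Sphere → Sphere} (hφ : φ ∈ Rat d)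
    (hJ : ∀ x, J (φ x) = φ (J x)) : φ ∈ RealRat d := by
  obtain ⟨P, Q, hco, hdeg, rfl⟩ := hφ
  have hcross : P.map (starRingEnd ℂ) * Q = P * Q.map (starRingEnd ℂ) := by
    refine Polynomial.funext fun z => ?_
    rw [eval_mul, eval_mul, eval_map_conj, eval_map_conj]
    have h := hJ ((starRingEnd ℂ z : ℂ) : Sphere)
    rw [J_coe, Complex.conj_conj] at h
    by_cases hz : Q.eval z = 0
    · by_cases hz' : Q.eval (starRingEnd ℂ z) = 0
      · simp [hz, hz']
      · simp [quotientMap, hz, hz', J_coe] at h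
    · by_cases hz' : Q.eval (starRingEnd ℂ z) = 0
      · simp [quotientMap, hz, hz', J_infty] at h
      · have hz'' : starRingEnd ℂ (Q.eval (starRingEnd ℂ z)) ≠ 0 := by simpa using hz'
        simp only [quotientMap, OnePoint.elim_some, hz, hz', if_false, J_coe,
          OnePoint.coe_eq_coe, map_div₀] at h
        exact (div_eq_div_iff hz'' hz).1 h
  obtain ⟨u, v, huv⟩ := id hco
  obtain ⟨l, hl⟩ : ∃ l : ℂ, P.map (starRingEnd ℂ) = P * C l ∧ Q.map (starRingEnd ℂ) = Q * C l := by
    let s := u * P.map (starRingEnd ℂ) + v * Q.map (starRingEnd ℂ)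
    have hPs : P.map (starRingEnd ℂ) = P * s := by
      linear_combination (-P.map (starRingEnd ℂ)) * huv + v * hcross
    have hQs : Q.map (starRingEnd ℂ) = Q * s := by
      linear_combination (-Q.map (starRingEnd ℂ)) * huv - u * hcross
    have hs : IsUnit s := ((isCoprime_map (starRingEnd ℂ)).2 hco).isUnit_of_dvd'
      (hPs ▸ dvd_mul_left _ _) (hQs ▸ dvd_mul_left _ _)
    obtain ⟨l, -, hl⟩ := isUnit_iff.1 hs
    exact ⟨l, by rw [hl]; exact hPs, by rw [hl]; exact hQs⟩
  have hPl : ∀ i, starRingEnd ℂ (P.coeff i) = P.coeff i * l := fun i => by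
    rw [← coeff_map, hl.1, coeff_mul_C]
  have hQl : ∀ i, starRingEnd ℂ (Q.coeff i) = Q.coeff i * l := fun i => by
    rw [← coeff_map, hl.2, coeff_mul_C]
  obtain ⟨c, hc, hcl⟩ : ∃ c : ℂ, c ≠ 0 ∧ starRingEnd ℂ c = c * l := by
    by_cases hP : P = 0
    · have hQ : Q ≠ 0 := by
        rintro rfl
        subst hP
        exact not_isCoprime_zero_zero hco
      exact ⟨_, leadingCoeff_ne_zero.2 hQ, hQl _⟩
    · exact ⟨_, leadingCoeff_ne_zero.2 hP, hPl _⟩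
  have hl0 : l ≠ 0 := by
    rintro rfl
    rw [mul_zero] at hcl
    exact hc (by simpa using hcl)
  have hreal : ∀ x, starRingEnd ℂ x = x * l → starRingEnd ℂ (c⁻¹ * x) = c⁻¹ * x := by
    intro x hx
    rw [map_mul, map_inv₀, hx, hcl]
    field_simp
  obtain ⟨P', hP'⟩ := exists_real_polynomial (P := C c⁻¹ * P) fun i => by
    rw [coeff_C_mul]; exact hreal _ (hPl i)
  obtain ⟨Q', hQ'⟩ := exists_real_polynomial (P := C c⁻¹ * Q) fun i => by
    rw [coeff_C_mul]; exact hreal _ (hQl i)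
  have hu : IsUnit (C c⁻¹ : ℂ[X]) := isUnit_C.2 (inv_ne_zero hc).isUnit
  refine ⟨P', Q', ?_, ?_, ?_⟩
  · rw [← isCoprime_map Complex.ofRealHom, hP', hQ']
    exact (isCoprime_mul_unit_left hu P Q).2 hco
  · rw [← natDegree_map Complex.ofRealHom (p := P'), ← natDegree_map Complex.ofRealHom (p := Q'),
      hP', hQ', natDegree_C_mul (inv_ne_zero hc), natDegree_C_mul (inv_ne_zero hc), hdeg]
  · rw [hP', hQ', quotientMap_C_mul (inv_ne_zero hc)]

lemma affine_pow {T : Equiv.Perm Sphere} {s t : ℂ}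
    (hz : ∀ z : ℂ, T z = ((s * z + t : ℂ) : Sphere)) (n : ℕ) :
    ∃ t' : ℂ, ∀ z : ℂ, (T ^ n) z = ((s ^ n * z + t' : ℂ) : Sphere) := by
  induction n with
  | zero => exact ⟨0, fun z => by simp⟩
  | succ n ih =>
    obtain ⟨t', ht'⟩ := ih
    refine ⟨s ^ n * t + t', fun z => ?_⟩
    rw [pow_succ, Equiv.Perm.mul_apply, hz, ht', OnePoint.coe_eq_coe]
    ring

/-- An antiholomorphic Möbius transformation with a fixed point whose square has finite order is
conjugate to complex conjugation. With the fixed point at `∞` it is `z ↦ a * conj z + b`, whose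
square has linear coefficient `|a| ^ 2`; so `|a| = 1`, and the square is a translation of finite
order, hence trivial. -/
lemma exists_conj_J {R : Equiv.Perm Sphere} (hR : R ∈ antiMobius) {p : Sphere} (hp : R p = p)
    (hfin : IsOfFinOrder (R * R)) : ∃ T ∈ mobiusGroup, T * R = J * T := by
  obtain ⟨S, hS, hSp⟩ := exists_mobius_eq_infty p
  have hSinv : S.symm ∞ = p := by rw [← hSp]; simp
  obtain ⟨U, hU⟩ : ∃ U, U = S * R * S⁻¹ := ⟨_, rfl⟩
  have hUanti : U ∈ antiMobius := by
    rw [hU]; exact anti_mul_mobius (mobius_mul_anti hS hR) (inv_mem hS)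
  have hUinf : U ∞ = ∞ := by simp [hU, hSinv, hp, hSp]
  have hUfin : IsOfFinOrder (U * U) := by
    have : IsOfFinOrder (S * (R * R) * S⁻¹) := by
      simpa using (MulAut.conj S).toMonoidHom.isOfFinOrder hfin
    rw [hU]
    convert this using 1
    group
  obtain ⟨a, b, ha, hab⟩ := anti_affine hUanti hUinf
  have hsq : ∀ z : ℂ, (U * U) z =
      ((a * starRingEnd ℂ a * z + (a * starRingEnd ℂ b + b) : ℂ) : Sphere) := fun z => by
    rw [Equiv.Perm.mul_apply, hab, hab, OnePoint.coe_eq_coe, map_add, map_mul, Complex.conj_conj]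
    ring
  have hsqinf : (U * U) ∞ = ∞ := by rw [Equiv.Perm.mul_apply, hUinf, hUinf]
  have hnorm : Complex.normSq a = 1 := by
    obtain ⟨n, hn, hpow⟩ := isOfFinOrder_iff_pow_eq_one.1 hUfin
    obtain ⟨t, ht⟩ := affine_pow hsq n
    have h0 := ht 0
    have h1 := ht 1
    rw [hpow, Equiv.Perm.one_apply, OnePoint.coe_eq_coe] at h0 h1
    have : (a * starRingEnd ℂ a) ^ n = 1 := by linear_combination h0 - h1
    rw [Complex.mul_conj] at this
    exact (pow_eq_one_iff_of_nonneg (Complex.normSq_nonneg a) hn.ne').1 (by exact_mod_cast this)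
  have haa : a * starRingEnd ℂ a = 1 := by rw [Complex.mul_conj, hnorm, Complex.ofReal_one]
  have hone : U * U = 1 := translation_eq_one hUfin hsqinf (b := a * starRingEnd ℂ b + b)
    fun z => by rw [hsq, haa, one_mul]
  have hb : a * starRingEnd ℂ b + b = 0 := by
    have h0 := hsq 0
    rw [hone, Equiv.Perm.one_apply, OnePoint.coe_eq_coe] at h0
    linear_combination -h0
  obtain ⟨u, hu⟩ := IsAlgClosed.exists_pow_nat_eq a (n := 2) (by norm_num)
  have hu1 : u * starRingEnd ℂ u = 1 := by
    have h1 : (Complex.normSq u) ^ 2 = 1 := by rw [← map_pow, hu, hnorm]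
    have h2 := (pow_eq_one_iff_of_nonneg (Complex.normSq_nonneg u) two_ne_zero).1 h1
    rw [Complex.mul_conj, h2, Complex.ofReal_one]
  have hu0 : u ≠ 0 := left_ne_zero_of_mul_eq_one hu1
  -- `b / 2` is a fixed point of `U`, and `z ↦ u * z + b / 2` maps the real line to the fixed line.
  obtain ⟨V, hV, hVinf, hVz⟩ := exists_affine hu0 (b / 2)
  have hUV : U * V = V * J := Equiv.ext fun x => by
    induction x using OnePoint.rec with
    | infty => rw [Equiv.Perm.mul_apply, Equiv.Perm.mul_apply, J_infty, hVinf, hUinf]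
    | coe z =>
      rw [Equiv.Perm.mul_apply, Equiv.Perm.mul_apply, J_coe, hVz, hVz, hab, OnePoint.coe_eq_coe,
        map_add, map_mul, map_div₀, Complex.conj_ofNat, ← hu]
      rw [← hu] at hb
      linear_combination u * starRingEnd ℂ z * hu1 + hb / 2
  refine ⟨V⁻¹ * S, mul_mem (inv_mem hV) hS, ?_⟩
  have : V⁻¹ * S * R = V⁻¹ * (U * V) * V⁻¹ * S := by rw [hU]; group
  rw [this, hUV]
  group

lemma isReal_of_anti_fixed {d : ℕ} {φ : Sphere → Sphere} (hφ : φ ∈ Rat d)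
    {R : Equiv.Perm Sphere} (hR : R ∈ antiMobius) (hRφ : ∀ x, R (φ x) = φ (R x))
    {p : Sphere} (hp : R p = p) (hfin : IsOfFinOrder (R * R)) : IsReal d φ := by
  obtain ⟨T, hT, hTR⟩ := exists_conj_J hR hp hfin
  have hTR : ∀ x, T (R x) = J (T x) := fun x => congrArg (· x) hTR
  refine ⟨T, hT, mem_RealRat_of_commute_J (conj_mem_Rat hφ hT) fun x => ?_⟩
  change J (T (φ (T.symm x))) = T (φ (T.symm (J x)))
  have : T.symm (J x) = R (T.symm x) := by rw [Equiv.symm_apply_eq, hTR, Equiv.apply_symm_apply]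
  rw [this, ← hRφ, hTR]

lemma isReal_of_reflection {d : ℕ} {φ : Sphere → Sphere} (hφ : φ ∈ Rat d)
    {R : Equiv.Perm Sphere} (hR : R ∈ antiMobius) (hRφ : ∀ x, R (φ x) = φ (R x))
    {p : Sphere} (hp : R p = p) (h1 : R * R = 1) : IsReal d φ :=
  isReal_of_anti_fixed hφ hR hRφ hp (h1 ▸ IsOfFinOrder.one)

/-! ### Rational maps of degree at most one -/

lemma J_mem_antiMobius : J ∈ antiMobius := ⟨1, one_mem _, (one_mul J).symm⟩

lemma IsReal.of_conj {d : ℕ} {φ : Sphere → Sphere} {T : Equiv.Perm Sphere}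
    (hT : T ∈ mobiusGroup) (h : IsReal d (conj T φ)) : IsReal d φ := by
  obtain ⟨S, hS, h⟩ := h
  exact ⟨S * T, mul_mem hS hT, h⟩

lemma commute_conj {φ : Sphere → Sphere} {R : Equiv.Perm Sphere}
    (hRφ : ∀ x, R (φ x) = φ (R x)) (T : Equiv.Perm Sphere) (x : Sphere) :
    (T * R * T⁻¹) (conj T φ x) = conj T φ ((T * R * T⁻¹) x) := by
  simp [conj, hRφ]

/-- A map `z ↦ a * z` with an antiholomorphic symmetry has `a` real or `|a| = 1`, according to
whether the symmetry fixes or exchanges the fixed points `0` and `∞`. It then commutes with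
`z ↦ conj z` or with `z ↦ 1 / conj z`. -/
lemma isReal_homothety {φ : Sphere → Sphere} (hφ : φ ∈ Rat 1) {a : ℂ} (ha : a ≠ 0) (ha1 : a ≠ 1)
    (hinf : φ ∞ = ∞) (hz : ∀ z : ℂ, φ z = ((a * z : ℂ) : Sphere))
    {R : Equiv.Perm Sphere} (hR : R ∈ antiMobius) (hRφ : ∀ x, R (φ x) = φ (R x)) :
    IsReal 1 φ := by
  have hfix : ∀ z : ℂ, φ z = z → z = 0 := fun z h => by
    rw [hz, OnePoint.coe_eq_coe] at h
    have : (a - 1) * z = 0 := by linear_combination h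
    exact (mul_eq_zero.1 this).resolve_left (sub_ne_zero.2 ha1)
  by_cases hRinf : R ∞ = ∞
  · obtain ⟨c, e, hc, hRz⟩ := anti_affine hR hRinf
    have he := hRφ ((0 : ℂ) : Sphere)
    rw [hz, mul_zero, hRz, map_zero, mul_zero, zero_add] at he
    have he := hfix e he.symm
    have h1 := hRφ ((1 : ℂ) : Sphere)
    rw [hz, hRz, hRz, hz, OnePoint.coe_eq_coe, he, map_one] at h1
    have hconj : starRingEnd ℂ a = a := mul_left_cancel₀ hc (by
      rw [mul_one] at h1
      linear_combination h1)
    refine isReal_of_reflection hφ J_mem_antiMobius (fun x => ?_) J_infty J_mul_J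
    induction x using OnePoint.rec with
    | infty => rw [hinf, J_infty, hinf]
    | coe z => rw [hz, J_coe, J_coe, hz, map_mul, hconj]
  · obtain ⟨w, hw⟩ := OnePoint.ne_infty_iff_exists.1 hRinf
    have hw0 : w = 0 := hfix w (by rw [hw, ← hRφ, hinf])
    rw [hw0] at hw
    have hR0 : R ((0 : ℂ) : Sphere) = ∞ := by
      by_contra h
      obtain ⟨v, hv⟩ := OnePoint.ne_infty_iff_exists.1 h
      have hv0 : v = 0 := hfix v (by rw [hv, ← hRφ, hz, mul_zero])
      rw [hv0] at hv
      exact OnePoint.infty_ne_coe _ (R.injective (hw.symm.trans hv))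
    obtain ⟨T, hT, rfl⟩ := hR
    obtain ⟨α, β, γ, δ, hdet, hT⟩ := mem_mobiusGroup_iff.1 hT
    have hTz : ∀ z : ℂ, (T * J) z = pt (α * starRingEnd ℂ z + β) (γ * starRingEnd ℂ z + δ) :=
      fun z => by
        rw [Equiv.Perm.mul_apply, J_coe, ← pt_one, hT _ _ (by simp), mul_one, mul_one]
    have hδ : δ = 0 := by
      rw [hTz, pt_eq_infty_iff] at hR0
      simpa using hR0
    have hTinf : pt α γ = ((0 : ℂ) : Sphere) := by
      rw [hw, Equiv.Perm.mul_apply, J_infty, ← pt_zero 1, hT _ _ (by simp)]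
      simp
    have hγ : γ ≠ 0 := by
      rintro rfl
      rw [pt_zero] at hTinf
      exact OnePoint.infty_ne_coe _ hTinf
    have hα : α = 0 := by
      rw [pt_of_ne hγ, OnePoint.coe_eq_coe] at hTinf
      simpa [hγ] using hTinf
    subst hα hδ
    have hβ : β ≠ 0 := by rintro rfl; simp at hdet
    have ha' : starRingEnd ℂ a ≠ 0 := by simpa using ha
    have haa : a * starRingEnd ℂ a = 1 := by
      have h1 := hRφ ((1 : ℂ) : Sphere)
      simp only [hz, hTz, map_one, mul_one, add_zero, zero_mul, zero_add] at h1
      rw [pt_of_ne hγ, hz, pt_of_ne (mul_ne_zero hγ ha'), OnePoint.coe_eq_coe] at h1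
      field_simp at h1
      linear_combination -h1
    obtain ⟨I, hI, hIpt⟩ := exists_mobius (a := 0) (b := 1) (c := 1) (d := 0) (by simp)
    have hIJ : ∀ x y : ℂ, (x ≠ 0 ∨ y ≠ 0) →
        (I * J) (pt x y) = pt (starRingEnd ℂ y) (starRingEnd ℂ x) := fun x y hxy => by
      rw [Equiv.Perm.mul_apply, J_pt, hIpt _ _ (by simpa using hxy)]
      simp
    have hφpt : ∀ x y : ℂ, φ (pt x y) = pt (a * x) y := fun x y => by
      by_cases hy : y = 0
      · rw [hy, pt_zero, pt_zero, hinf]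
      · rw [pt_of_ne hy, hz, pt_of_ne hy, mul_div_assoc]
    refine isReal_of_reflection hφ (p := pt 1 1) ⟨I, hI, rfl⟩ (fun x => ?_) ?_ ?_
    · obtain ⟨x, y, hxy, rfl⟩ := exists_pt x
      rw [hφpt, hIJ _ _ (by simpa [ha] using hxy), hIJ _ _ hxy, hφpt, map_mul,
        ← pt_smul ha' (a * _)]
      congr 1
      linear_combination -starRingEnd ℂ y * haa
    · rw [hIJ _ _ (by simp), map_one]
    · refine Equiv.ext fun x => ?_
      obtain ⟨x, y, hxy, rfl⟩ := exists_pt x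
      rw [Equiv.Perm.mul_apply, hIJ _ _ hxy, hIJ _ _ (by simpa using hxy.symm)]
      simp

/-- A Möbius transformation fixing `∞` that has an antiholomorphic symmetry is real. -/
lemma isReal_affine {φ : Sphere → Sphere} (hφ : φ ∈ Rat 1) (hinf : φ ∞ = ∞)
    {R : Equiv.Perm Sphere} (hR : R ∈ antiMobius) (hRφ : ∀ x, R (φ x) = φ (R x)) :
    IsReal 1 φ := by
  obtain ⟨a, b, ha, hz⟩ : ∃ a b : ℂ, a ≠ 0 ∧ ∀ z : ℂ, φ z = ((a * z + b : ℂ) : Sphere) := by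
    obtain ⟨P, Q, hP, hQ, h0, hφ⟩ := mem_Rat_iff.1 hφ
    have hq1 : Q.coeff 1 = 0 := by
      have := hφ 1 0 (by simp)
      rw [pt_zero, hinf, eq_comm, pt_eq_infty_iff, form_zero] at this
      simpa using this
    have hp1 : P.coeff 1 ≠ 0 := by
      have := h0 1 0 (by simp)
      rw [form_zero, form_zero, hq1] at this
      simpa using this
    have hq0 : Q.coeff 0 ≠ 0 := by
      intro hq0
      have := h0 (-P.coeff 0 / P.coeff 1) 1 (by simp)
      simp [form, Finset.sum_range_succ, hq0, hq1, mul_div_cancel₀ _ hp1] at this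
    refine ⟨P.coeff 1 / Q.coeff 0, P.coeff 0 / Q.coeff 0, div_ne_zero hp1 hq0, fun z => ?_⟩
    have h := hφ z 1 (by simp)
    rw [pt_one] at h
    have hQf : form Q 1 z 1 = Q.coeff 0 := by simp [form, Finset.sum_range_succ, hq1]
    have hPf : form P 1 z 1 = P.coeff 0 + P.coeff 1 * z := by simp [form, Finset.sum_range_succ]
    rw [h, hQf, hPf, pt_of_ne hq0, OnePoint.coe_eq_coe]
    ring
  by_cases ha1 : a = 1
  · subst ha1
    -- The translation by `b` commutes with the reflection `z ↦ c * conj z`, where `c = b / conj b`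
    -- (and `c = 1` if `b = 0`).
    obtain ⟨c, hc, hcb⟩ : ∃ c : ℂ, c * starRingEnd ℂ c = 1 ∧ c * starRingEnd ℂ b = b := by
      by_cases hb : b = 0
      · exact ⟨1, by simp, by simp [hb]⟩
      · have hb' : starRingEnd ℂ b ≠ 0 := by simpa using hb
        refine ⟨b / starRingEnd ℂ b, ?_, div_mul_cancel₀ _ hb'⟩
        rw [map_div₀, Complex.conj_conj]
        field_simp
    obtain ⟨S, hS, hSinf, hSz⟩ := exists_affine (left_ne_zero_of_mul_eq_one hc) 0
    have hSJinf : (S * J) ∞ = ∞ := by rw [Equiv.Perm.mul_apply, J_infty, hSinf]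
    have hSJ : ∀ z : ℂ, (S * J) z = ((c * starRingEnd ℂ z : ℂ) : Sphere) := fun z => by
      rw [Equiv.Perm.mul_apply, J_coe, hSz, add_zero]
    refine isReal_of_reflection hφ ⟨S, hS, rfl⟩ (fun x => ?_) hSJinf ?_
    · induction x using OnePoint.rec with
      | infty => rw [hinf, hSJinf, hinf]
      | coe z =>
        rw [hz, hSJ, hSJ, hz, OnePoint.coe_eq_coe, map_add, map_mul, map_one]
        linear_combination hcb
    · refine perm_eq_one_of_coe (by rw [Equiv.Perm.mul_apply, hSJinf, hSJinf]) fun z => ?_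
      rw [Equiv.Perm.mul_apply, hSJ, hSJ, OnePoint.coe_eq_coe, map_mul, Complex.conj_conj]
      linear_combination z * hc
  · have ha1' : 1 - a ≠ 0 := sub_ne_zero.2 (Ne.symm ha1)
    obtain ⟨S, hS, hSinf, hSz⟩ := exists_affine one_ne_zero (-(b / (1 - a)))
    have hSsymm : ∀ z : ℂ, S.symm z = ((z + b / (1 - a) : ℂ) : Sphere) := fun z => by
      rw [Equiv.symm_apply_eq, hSz, OnePoint.coe_eq_coe]
      ring
    have hSsymminf : S.symm ∞ = ∞ := by rw [Equiv.symm_apply_eq, hSinf]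
    refine IsReal.of_conj hS (isReal_homothety (conj_mem_Rat hφ hS) ha ha1 ?_ (fun z => ?_)
      (anti_mul_mobius (mobius_mul_anti hS hR) (inv_mem hS)) (commute_conj hRφ S))
    · simp [conj, hSsymminf, hinf, hSinf]
    · change S (φ (S.symm z)) = _
      rw [hSsymm, hz, hSz, OnePoint.coe_eq_coe]
      field_simp
      ring

lemma isReal_of_degree_le_one {d : ℕ} (hd : d ≤ 1) {φ : Sphere → Sphere} (hφ : φ ∈ Rat d)
    {R : Equiv.Perm Sphere} (hR : R ∈ antiMobius) (hRφ : ∀ x, R (φ x) = φ (R x)) :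
    IsReal d φ := by
  obtain ⟨p, hp⟩ := exists_fixedPoint hφ
  obtain ⟨T, hT, hTp⟩ := exists_mobius_eq_infty p
  have hTinv : T.symm ∞ = p := by rw [← hTp]; simp
  have hinf : conj T φ ∞ = ∞ := by simp [conj, hTinv, hp, hTp]
  have hφT := conj_mem_Rat hφ hT
  refine IsReal.of_conj hT ?_
  obtain rfl | rfl : d = 0 ∨ d = 1 := by omega
  · have hconst : ∀ x, conj T φ x = ∞ := by
      obtain ⟨P, Q, -, -, -, h⟩ := mem_Rat_iff.1 hφT
      have h' : ∀ x, conj T φ x = pt (P.coeff 0) (Q.coeff 0) := fun x => by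
        obtain ⟨x, y, hxy, rfl⟩ := exists_pt x
        simp [h x y hxy, form]
      exact fun x => by rw [h', ← h' ∞, hinf]
    exact isReal_of_reflection hφT J_mem_antiMobius
      (fun x => by rw [hconst, hconst, J_infty]) J_infty J_mul_J
  · exact isReal_affine hφT hinf (anti_mul_mobius (mobius_mul_anti hT hR) (inv_mem hT))
      (commute_conj hRφ T)

/-! ### Pseudo-real maps -/

/-- Without a global fixed point on the sphere, `Aut φ` has a composite with `R` that fixes a
point, and this makes `φ` real. -/
lemma isCyclic_Aut_of_not_isReal {d : ℕ} {φ : Sphere → Sphere} (hφ : φ ∈ Rat d)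
    [Finite (Aut φ)] {R : Equiv.Perm Sphere} (hR : R ∈ antiMobius)
    (hRφ : ∀ x, R (φ x) = φ (R x)) (hreal : ¬ IsReal d φ) : IsCyclic (Aut φ) := by
  rcases subsingleton_or_nontrivial (Aut φ) with _ | _
  · infer_instance
  have hRinv : ∀ x, φ (R.symm x) = R.symm (φ x) := fun x => by
    rw [Equiv.eq_symm_apply, hRφ, Equiv.apply_symm_apply]
  have hcomm : ∀ g : Aut φ, ∀ x, g.1 (φ x) = φ (g.1 x) := fun g => conj_eq_iff.1 g.2.2
  have hnorm : ∀ g : Aut φ, ∃ g' : Aut φ, ∀ x : Sphere, R (g • x) = g' • R x := fun g => by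
    refine ⟨⟨R * g.1 * R⁻¹, anti_mul_anti (anti_mul_mobius hR g.2.1) (anti_inv hR),
      conj_eq_iff.2 fun x => ?_⟩, fun x => ?_⟩
    · change R (g.1 (R.symm (φ x))) = φ (R (g.1 (R.symm x)))
      rw [← hRinv, hcomm, hRφ]
    · change R (g.1 x) = R (g.1 (R.symm (R x)))
      rw [Equiv.symm_apply_apply]
  have hsq : ∃ g : Aut φ, ∀ x : Sphere, R (R x) = g • x :=
    ⟨⟨R * R, anti_mul_anti hR hR, conj_eq_iff.2 fun x => by
      rw [Equiv.Perm.mul_apply, hRφ, hRφ, Equiv.Perm.mul_apply]⟩, fun x => rfl⟩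
  have hpair : ∀ g : Aut φ, g ≠ 1 →
      ∃ p q : Sphere, p ≠ q ∧ ∀ x, g • x = x ↔ x = p ∨ x = q := fun g hg =>
    mobius_fixed_pair g.2.1 ((Aut φ).subtype.isOfFinOrder (isOfFinOrder_of_finite g))
      fun h => hg (Subtype.ext h)
  rcases exists_fixed_or_normalizer_fixed hpair R hnorm hsq with ⟨x, hx⟩ | ⟨x, g, hx⟩
  · exact isCyclic_of_fixed (fun g hg => hg.1) (p := x) fun g hg => hx ⟨g, hg⟩
  · refine absurd ?_ hreal
    have hg : g⁻¹.1 * R ∈ antiMobius := mobius_mul_anti g⁻¹.2.1 hR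
    have hgφ : ∀ y, (g⁻¹.1 * R) (φ y) = φ ((g⁻¹.1 * R) y) := fun y => by
      rw [Equiv.Perm.mul_apply, hRφ, hcomm, Equiv.Perm.mul_apply]
    refine isReal_of_anti_fixed hφ hg hgφ (p := x) ?_ ?_
    · rw [Equiv.Perm.mul_apply, hx]
      exact inv_smul_smul g x
    · have hmem : g⁻¹.1 * R * (g⁻¹.1 * R) ∈ Aut φ := ⟨anti_mul_anti hg hg, conj_eq_iff.2 fun y => by
        rw [Equiv.Perm.mul_apply, hgφ, hgφ]
        rfl⟩
      exact (Aut φ).subtype.isOfFinOrder (isOfFinOrder_of_finite (⟨_, hmem⟩ : Aut φ))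

end RationalMap

end

theorem theorem3p1 (d : ℕ) (φ : RationalMap.Sphere → RationalMap.Sphere)
    (hφ : φ ∈ RationalMap.Rat d) (hpr : RationalMap.IsPseudoReal d φ) :
    Finite (RationalMap.Aut φ) ∧ IsCyclic (RationalMap.Aut φ) := by
  obtain ⟨⟨R, hR, hRφ⟩, hreal⟩ := hpr
  have hRφ := RationalMap.conj_eq_iff.1 hRφ
  have hd : 2 ≤ d := by
    by_contra hd
    exact hreal (RationalMap.isReal_of_degree_le_one (by omega) hφ hR hRφ)
  have := RationalMap.finite_Aut hd hφ
  exact ⟨this, RationalMap.isCyclic_Aut_of_not_isReal hφ hR hRφ hreal⟩
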